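/- Let $V$ be a discrete valuation ring with quotient field $F$, let $K/F$ be a finite Galois extension with Galois group $G$, and let $S$ be the integral closure of $V$ in $K$; assume that $S$ is unramified over $V$. Let $f : G\times G\to K^{\times}$ be a normalized two-cocycle, i.e. $\sigma(f(\tau,\rho))\,f(\sigma,\tau\rho)=f(\sigma,\tau)\,f(\sigma\tau,\rho)$ and $f(1,\sigma)=f(\sigma,1)=1$ for all $\sigma,\tau,\rho\in G$, and suppose that $f(G\times G)\subseteq S\setminus\{0\}$. Let $A_f=\bigoplus_{\sigma\in G}Sx_\sigma$ be the crossed-product order, with multiplication $x_\sigma s=\sigma(s)x_\sigma$ ($s\in S$) and $x_\sigma x_\tau=f(\sigma,\tau)x_{\sigma\tau}$. Then $A_f$ is hereditary (all its left ideals and all its right ideals are projective) if and only if $f(\tau,\gamma)\notin M^2$ for all $\tau,\gamma\in G$ and every maximal ideal $M$ of $S$. Equivalently, $A_f$ is hereditary if and only if all the values $f(\tau,\gamma)$ are square-free elements of $S$. -/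

import Mathlib

/-- A (not necessarily commutative) ring is *hereditary* if all its left ideals and all its right
ideals are projective modules. `Ideal R` is the type of left ideals of `R`, and the right ideals
of `R`, with their right module structure, are the left ideals of the opposite ring. -/
def IsHereditaryRing (R : Type*) [Ring R] : Prop :=
  (∀ I : Ideal R, Module.Projective R I) ∧ (∀ I : Ideal Rᵐᵒᵖ, Module.Projective Rᵐᵒᵖ I)

/-- A normalized two-cocycle `f ∈ Z²(Gal(K/F), Kˣ)` all of whose values lie in the integral
closure of `V` in `K`. -/
structure IntegralTwoCocycle (V F K : Type*) [CommRing V] [Field F] [Field K]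
    [Algebra F K] [Algebra V K] where
  /-- the underlying function -/
  toFun : Gal(K/F) × Gal(K/F) → Kˣ
  isMulCocycle₂ : groupCohomology.IsMulCocycle₂ toFun
  map_one_left : ∀ σ : Gal(K/F), toFun (1, σ) = 1
  map_one_right : ∀ σ : Gal(K/F), toFun (σ, 1) = 1
  integral : ∀ σ τ : Gal(K/F), (toFun (σ, τ) : K) ∈ integralClosure V K

namespace IntegralTwoCocycle

variable {V F K : Type*} [CommRing V] [Field F] [Field K] [Algebra F K] [Algebra V K]

/-- The value `f(σ, τ)` as an element of the integral closure of `V` in `K`. -/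
def val (f : IntegralTwoCocycle V F K) (σ τ : Gal(K/F)) : integralClosure V K :=
  ⟨(f.toFun (σ, τ) : K), f.integral σ τ⟩

theorem cocycle (f : IntegralTwoCocycle V F K) (σ τ ρ : Gal(K/F)) :
    (f.toFun (σ * τ, ρ) : K) * f.toFun (σ, τ) = σ (f.toFun (τ, ρ)) * f.toFun (σ, τ * ρ) := by
  have h := congrArg (Units.val) (f.isMulCocycle₂ σ τ ρ)
  simpa using h

/-- The underlying type of the crossed-product algebra `(K/F, Gal(K/F), f) = ∑ K x_σ`. The
function `a` stands for the element `∑ a(σ) x_σ`. -/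
def CrossedProduct (_f : IntegralTwoCocycle V F K) : Type _ := Gal(K/F) → K

namespace CrossedProduct

variable (f : IntegralTwoCocycle V F K)

instance : AddCommGroup f.CrossedProduct := inferInstanceAs (AddCommGroup (Gal(K/F) → K))

variable {f} in
@[ext] theorem ext {a b : f.CrossedProduct} (h : ∀ σ, a σ = b σ) : a = b := funext h

@[simp] theorem zero_apply (σ : Gal(K/F)) : (0 : f.CrossedProduct) σ = 0 := rfl

variable {f} in
@[simp] theorem add_apply (a b : f.CrossedProduct) (σ : Gal(K/F)) : (a + b) σ = a σ + b σ := rfl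

variable {f} in
@[simp] theorem neg_apply (a : f.CrossedProduct) (σ : Gal(K/F)) : (-a) σ = -a σ := rfl

open Classical in
/-- The identity element is `x_1`. -/
noncomputable instance : One f.CrossedProduct := ⟨fun σ => if σ = 1 then 1 else 0⟩

open Classical in
theorem one_apply (σ : Gal(K/F)) : (1 : f.CrossedProduct) σ = if σ = 1 then 1 else 0 := rfl

variable [FiniteDimensional F K]

/-- The product determined by additivity and `(s x_σ)(t x_τ) = s σ(t) f(σ, τ) x_{στ}`: the
coefficient at `x_ρ` collects the pairs `(σ, τ)` with `τ = σ⁻¹ρ`. -/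
noncomputable instance : Mul f.CrossedProduct :=
  ⟨fun a b => fun ρ => ∑ σ : Gal(K/F), a σ * σ (b (σ⁻¹ * ρ)) * f.toFun (σ, σ⁻¹ * ρ)⟩

variable {f} in
theorem mul_apply (a b : f.CrossedProduct) (ρ : Gal(K/F)) :
    (a * b) ρ = ∑ σ : Gal(K/F), a σ * σ (b (σ⁻¹ * ρ)) * f.toFun (σ, σ⁻¹ * ρ) := rfl

variable {f} in
protected theorem mul_assoc (a b c : f.CrossedProduct) : a * b * c = a * (b * c) := by
  ext ρ
  simp only [mul_apply, map_sum, Finset.sum_mul, Finset.mul_sum]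
  rw [Finset.sum_comm]
  refine Finset.sum_congr rfl fun σ _ => ?_
  refine Fintype.sum_equiv (Equiv.mulLeft σ⁻¹) _ _ fun τ => ?_
  have h := f.cocycle σ (σ⁻¹ * τ) (τ⁻¹ * ρ)
  have e1 : σ⁻¹ * τ * (τ⁻¹ * ρ) = σ⁻¹ * ρ := by group
  have e2 : (σ⁻¹ * τ)⁻¹ * (σ⁻¹ * ρ) = τ⁻¹ * ρ := by group
  rw [mul_inv_cancel_left, e1] at h
  simp only [Equiv.coe_mulLeft, map_mul]
  rw [e2, ← AlgEquiv.mul_apply σ (σ⁻¹ * τ), mul_inv_cancel_left]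
  linear_combination (a σ * σ (b (σ⁻¹ * τ)) * τ (c (τ⁻¹ * ρ))) * h

noncomputable instance : Ring f.CrossedProduct where
  __ := (inferInstance : AddCommGroup f.CrossedProduct)
  left_distrib a b c := by
    ext ρ
    simp [mul_apply, mul_add, add_mul, Finset.sum_add_distrib]
  right_distrib a b c := by
    ext ρ
    simp [mul_apply, add_mul, Finset.sum_add_distrib]
  zero_mul a := by ext ρ; simp [mul_apply]
  mul_zero a := by ext ρ; simp [mul_apply]
  mul_assoc := CrossedProduct.mul_assoc
  one_mul a := by
    ext ρ
    rw [mul_apply, Finset.sum_eq_single 1]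
    · simp [one_apply, f.map_one_left]
    · intro σ _ h
      simp [one_apply, h]
    · simp
  mul_one a := by
    ext ρ
    rw [mul_apply, Finset.sum_eq_single ρ]
    · simp [one_apply, f.map_one_right]
    · intro σ _ h
      have : ¬ σ⁻¹ * ρ = 1 := fun h' => h (inv_mul_eq_one.mp h')
      simp [one_apply, this]
    · simp

end CrossedProduct

/-- The crossed-product order `A_f = ∑ S x_σ` inside `(K/F, Gal(K/F), f)`, where `S` is the
integral closure of `V` in `K`. -/
noncomputable def crossedProductOrder [Algebra V F] [IsScalarTower V F K] [FiniteDimensional F K]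
    (f : IntegralTwoCocycle V F K) : Subring f.CrossedProduct where
  carrier := {a | ∀ σ, a σ ∈ integralClosure V K}
  zero_mem' _ := zero_mem _
  add_mem' ha hb σ := add_mem (ha σ) (hb σ)
  neg_mem' ha σ := neg_mem (ha σ)
  one_mem' σ := by
    rw [CrossedProduct.one_apply]
    split_ifs
    · exact one_mem _
    · exact zero_mem _
  mul_mem' ha hb ρ := by
    rw [CrossedProduct.mul_apply]
    refine sum_mem fun σ _ => mul_mem (mul_mem (ha σ) ?_) (f.integral _ _)
    exact (hb (σ⁻¹ * ρ)).map (σ.toAlgHom.restrictScalars V)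

end IntegralTwoCocycle

/-!
Write `S` for the integral closure, `A` for the crossed-product order, `B ⊇ A` for the crossed
product over `K`, and `π` for (the image in `S` of) a uniformizer of `V`; it is central in `A`.
Since `S` is unramified over `V`, the element `π` generates the intersection of the maximal ideals
of `S` and lies in no square of a maximal ideal, and for `σ ≠ 1` no maximal ideal contains all the
differences `σ(c) - c`. A maximal ideal `M` makes the Galois group into a preordered set: `σ ≤ ρ` if
`f(σ, σ⁻¹ρ) ∉ M`. The cocycle identity gives transitivity, `1` is a least element, and if no value
of `f` is in the square of a maximal ideal then the preorder is total.

*The condition is sufficient.* Let `T` be the ideal of all `∑ s_σ x_σ` with `s_σ ∈ M` whenever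
`σ ≤ 1` for `M` (`radIdeal`). It is the Jacobson radical of `A`: its elements are nilpotent modulo
`π`, because their products climb strictly in the preorders (`exists_pow_coeff_mem`), and `A / T`
is semisimple, because two-sided ideals of `A` are graded up to a given prime of `S`
(`exists_monomial_mem`). The ideal `T` is projective: a greatest element `σ` for `M` gives an
element `w x_σ` with `T w x_σ ⊆ π A`, and these, multiplied by elements of `T`, generate `π`
(`projective_radIdeal`). Any ring with such a `T` has all its maximal left ideals projective, hence,
by Schanuel's argument along a composition series, all left ideals of finite colength. An arbitrary
left ideal is a direct summand of one of finite colength, as `B` is semisimple. Right ideals are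
left ideals of the crossed-product order of the opposite cocycle (`oppositeOrderEquiv`).

*The condition is necessary.* Each `f(τ, γ)` divides `f(τ, τ⁻¹)`, so suppose `f(τ, τ⁻¹) ∈ M²`. If
the left ideal `I = A π + A x_{τ⁻¹}` is projective, a dual basis gives `c_i ∈ A` and `t_i ∈ I` with
`I c_i ⊆ π A` and `∑ c_i t_i = π`. Comparing coefficients at `1`, every term of the sum falls
into `M²`, which contradicts `π ∉ M²` (`val_notMem_sq`).
-/

set_option linter.unusedSectionVars false

/-! ### Projectivity of left ideals -/

section HereditaryCriterion

variable {R : Type*} [Ring R]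

theorem Ideal.exists_mul_one_sub_mem_of_isSemisimpleRing_quotient (T : Ideal R) [T.IsTwoSided]
    [IsSemisimpleRing (R ⧸ T)] (N : Ideal R) :
    ∃ e ∈ N, ∀ n ∈ N, n * (1 - e) ∈ T := by
  obtain ⟨e', hidem, he'⟩ := IsSemisimpleRing.ideal_eq_span_idempotent
    (N.map (Ideal.Quotient.mk T))
  have hsurj : Function.Surjective (Ideal.Quotient.mk T) := Ideal.Quotient.mk_surjective
  obtain ⟨e, heN, rfl⟩ : ∃ e ∈ N, Ideal.Quotient.mk T e = e' :=
    (Ideal.mem_map_iff_of_surjective _ hsurj).1 (he' ▸ Ideal.mem_span_singleton_self e')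
  refine ⟨e, heN, fun n hn => ?_⟩
  have h := Ideal.mem_map_of_mem (Ideal.Quotient.mk T) hn
  rw [he'] at h
  obtain ⟨r, hr⟩ := Ideal.mem_span_singleton'.1 h
  rw [← Ideal.Quotient.eq_zero_iff_mem, map_mul, map_sub, map_one, ← hr, mul_assoc, mul_sub,
    mul_one, hidem.eq, sub_self, mul_zero]

/-- If `R / T` is semisimple, then `N = R e + T` with `e` idempotent modulo `T`, and `N` is a direct
summand of `R ⊕ T`. -/
theorem Module.Projective.of_isSemisimpleRing_quotient (T : Ideal R) [T.IsTwoSided]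
    [IsSemisimpleRing (R ⧸ T)] [Module.Projective R T] {N : Ideal R} (hTN : T ≤ N) :
    Module.Projective R N := by
  obtain ⟨e, he, h⟩ := T.exists_mul_one_sub_mem_of_isSemisimpleRing_quotient N
  let i : N →ₗ[R] R × T := LinearMap.prod N.subtype
    (((LinearMap.toSpanSingleton R R (1 - e)).comp N.subtype).codRestrict T
      fun n => by simpa using h n n.2)
  let s : R × T →ₗ[R] N := LinearMap.coprod (LinearMap.toSpanSingleton R N ⟨e, he⟩)
    (Submodule.inclusion hTN)
  refine Module.Projective.of_split i s (LinearMap.ext fun n => Subtype.ext ?_)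
  simp [i, s, mul_sub]

/-- If `P` is projective and `L` is maximal in `P`, then `P / L ≅ R / N` for a maximal left ideal
`N`, and Schanuel's lemma makes `L` a direct summand of `P ⊕ N`. -/
theorem Module.Projective.of_covBy {M : Type*} [AddCommGroup M] [Module R M]
    (hmax : ∀ N : Ideal R, N.IsMaximal → Module.Projective R N)
    {L P : Submodule R M} (hLP : L ⋖ P) [Module.Projective R P] : Module.Projective R L := by
  obtain ⟨p, hpP, hpL⟩ := SetLike.exists_of_lt hLP.lt
  have hgen : ∀ q ∈ P, q ∉ L → ∀ x ∈ P, ∃ l ∈ L, ∃ r : R, l + r • q = x := fun q hq hqL x hx => by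
    have hsup : L ⊔ Submodule.span R {q} = P :=
      (hLP.eq_or_eq le_sup_left (sup_le hLP.le (by simpa using hq))).resolve_left fun h =>
        hqL (h ▸ Submodule.mem_sup_right (Submodule.mem_span_singleton_self q))
    rw [← hsup] at hx
    simpa [Submodule.mem_sup, Submodule.mem_span_singleton] using hx
  let N : Ideal R := L.comap (LinearMap.toSpanSingleton R M p)
  have hN : ∀ r, r ∈ N ↔ r • p ∈ L := fun r => Iff.rfl
  have hNmax : N.IsMaximal := by
    refine Ideal.isMaximal_iff.2 ⟨fun h => hpL (by simpa [hN] using h), fun J r hNJ hr hrJ => ?_⟩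
    obtain ⟨l, hl, s, hs⟩ := hgen (r • p) (P.smul_mem r hpP) (by rwa [← hN]) p hpP
    have h1 : 1 - s * r ∈ N := by
      rw [hN, sub_smul, one_smul, mul_smul, sub_eq_of_eq_add hs.symm]
      exact hl
    simpa using J.add_mem (hNJ h1) (J.mul_mem_left s hrJ)
  have := hmax N hNmax
  -- a splitting of `L × R → P`, `(l, r) ↦ l + r • p`, whose kernel is a copy of `N`
  let π : L × R →ₗ[R] P := LinearMap.coprod (Submodule.inclusion hLP.le)
    (LinearMap.toSpanSingleton R P ⟨p, hpP⟩)
  obtain ⟨g, hg⟩ := Module.projective_lifting_property π LinearMap.id fun x => by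
    obtain ⟨l, hl, r, h⟩ := hgen p hpP hpL x x.2
    exact ⟨(⟨l, hl⟩, r), Subtype.ext (by simpa [π] using h)⟩
  have hg' (x : P) : ((g x).1 : M) + (g x).2 • p = x := by
    simpa [π] using congrArg Subtype.val (LinearMap.congr_fun hg x)
  let ι : L →ₗ[R] P := Submodule.inclusion hLP.le
  let γ : L →ₗ[R] N := ((LinearMap.snd R L R).comp (g.comp ι)).codRestrict N fun l => by
    have h := hg' (ι l)
    rw [hN]
    exact (add_mem_cancel_left (g (ι l)).1.2).1 (h ▸ l.2)
  let s : N →ₗ[R] L := ((LinearMap.toSpanSingleton R M p).comp N.subtype).codRestrict L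
    fun n => (hN n).1 n.2
  refine Module.Projective.of_split (LinearMap.prod ι γ)
    (LinearMap.coprod ((LinearMap.fst R L R).comp g) s) (LinearMap.ext fun l => Subtype.ext ?_)
  exact hg' (ι l)

theorem Ideal.projective_of_isArtinian_quotient [IsNoetherianRing R]
    (hmax : ∀ N : Ideal R, N.IsMaximal → Module.Projective R N)
    (L : Ideal R) [IsArtinian R (R ⧸ L)] : Module.Projective R L := by
  have htop : Module.Projective R ((⊤ : Submodule R (R ⧸ L)).comap L.mkQ) := by
    rw [Submodule.comap_top]
    exact .of_equiv' Submodule.topEquiv.symm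
  obtain ⟨Q, hQ, hmin⟩ := exists_minimal_of_wellFoundedLT
    (fun Q : Submodule R (R ⧸ L) => Module.Projective R (Q.comap L.mkQ)) ⟨_, htop⟩
  obtain rfl | hbot := eq_or_ne Q ⊥
  · have h : (⊥ : Submodule R (R ⧸ L)).comap L.mkQ = L := by
      rw [Submodule.comap_bot, Submodule.ker_mkQ]
    exact h ▸ hQ
  obtain ⟨Q', hQ'⟩ := exists_covBy_of_wellFoundedGT (a := Q) (by simpa using hbot)
  refine absurd (hmin (.of_covBy hmax (P := Q.comap L.mkQ) ?_) hQ'.le) hQ'.lt.not_ge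
  exact CovBy.image (Submodule.comapMkQOrderEmbedding L) hQ' ⟨by
    rintro _ ⟨Q₁, rfl⟩ _ ⟨Q₂, rfl⟩ X hX
    exact ⟨X.map L.mkQ, (Submodule.comap_map_mkQ L X).trans
      (sup_eq_right.2 ((Submodule.le_comap_mkQ L Q₁).trans hX.1))⟩⟩

/-- A left ideal is projective if it has a dual basis whose functionals are the maps
`y ↦ y * c i * ϖ⁻¹`, for a central regular element `ϖ`. -/
theorem Ideal.projective_of_sum_mul_eq {ϖ : R} (hc : ∀ a, ϖ * a = a * ϖ)
    (hreg : ∀ a b, a * ϖ = b * ϖ → a = b) (T : Ideal R) {ι : Type*} [Fintype ι] (c : ι → R)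
    (t : ι → T) (hct : ∀ i, ∀ y ∈ T, ∃ z, z * ϖ = y * c i) (hsum : ∑ i, c i * t i = ϖ) :
    Module.Projective R T := by
  choose φ hφ using fun (i : ι) (y : T) => hct i y y.2
  let φ' : T →ₗ[R] ι → R :=
    { toFun := fun y i => φ i y
      map_add' := fun x y => funext fun i => hreg _ _ (by simp [hφ, add_mul])
      map_smul' := fun r y => funext fun i => hreg _ _ (by simp [hφ, mul_assoc]) }
  refine Module.Projective.of_split φ' (Fintype.linearCombination R t)
    (LinearMap.ext fun y => Subtype.ext (hreg _ _ ?_))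
  simp only [LinearMap.comp_apply, Fintype.linearCombination_apply, Submodule.coe_sum,
    Submodule.coe_smul, smul_eq_mul, Finset.sum_mul, LinearMap.id_apply]
  calc ∑ i, φ' y i * (t i : R) * ϖ = ∑ i, y * (c i * t i) := by
        refine Finset.sum_congr rfl fun i _ => ?_
        rw [mul_assoc, ← hc, ← mul_assoc, ← mul_assoc]
        exact congrArg (· * _) (hφ i y)
    _ = y * ϖ := by rw [← Finset.mul_sum, hsum]

/-- A finitely generated projective left ideal that contains a central element `ϖ` has a dual basis;
here `c i` is the value at `ϖ` of the `i`th functional, and the value at `y` times `ϖ` is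
`y * c i`. -/
theorem Ideal.exists_sum_mul_eq_of_projective {ϖ : R} (hc : ∀ a, ϖ * a = a * ϖ) (I : Ideal R)
    (hI : ϖ ∈ I) (hfg : I.FG) [Module.Projective R I] :
    ∃ (n : ℕ) (c : Fin n → R) (t : Fin n → I), (∀ i, ∀ y ∈ I, ∃ z, ϖ * z = y * c i) ∧
      ∑ i, c i * t i = ϖ := by
  have : Module.Finite R I := Module.Finite.iff_fg.2 hfg
  obtain ⟨n, p, g, -, -, hpg⟩ := Module.Finite.exists_comp_eq_id_of_projective R I
  refine ⟨n, fun i => g ⟨ϖ, hI⟩ i, fun i => p fun j => if i = j then 1 else 0,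
    fun i y hy => ⟨g ⟨y, hy⟩ i, ?_⟩, ?_⟩
  · have h : ϖ • (⟨y, hy⟩ : I) = y • (⟨ϖ, hI⟩ : I) := Subtype.ext (hc y)
    simpa using congrFun ((g.map_smul _ _).symm.trans ((congrArg g h).trans (g.map_smul _ _))) i
  · have h := congrArg Subtype.val (LinearMap.congr_fun hpg ⟨ϖ, hI⟩)
    rw [LinearMap.comp_apply, LinearMap.id_apply, LinearMap.pi_apply_eq_sum_univ] at h
    simpa using h

/-- Let `B` be semisimple, obtained from `A` by inverting the central element `ϖ`. A left ideal `I`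
of `A` generates `B * e` for an idempotent `e`, and right multiplication by `e` makes `I` a direct
summand of the left ideal `{a | a * e ∈ I}`, which contains a power of `ϖ`. -/
theorem Subring.projective_ideal_of_isSemisimpleRing {B : Type*} [Ring B] [IsSemisimpleRing B]
    (A : Subring B) {ϖ : A} (hc : ∀ b, (ϖ : B) * b = b * ϖ)
    (hA : ∀ b : B, ∃ k : ℕ, (ϖ : B) ^ k * b ∈ A)
    (hL : ∀ (L : Ideal A) (k : ℕ), ϖ ^ k ∈ L → Module.Projective A L) (I : Ideal A) :
    Module.Projective A I := by
  have hcp (k : ℕ) (b : B) : (ϖ : B) ^ k * b = b * (ϖ : B) ^ k :=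
    (Commute.pow_left (hc b) k).eq
  -- `FI` is the left ideal of `B` generated by `I`
  let FI : Ideal B :=
    { carrier := {b | ∃ k : ℕ, ∃ a ∈ I, (ϖ : B) ^ k * b = a}
      zero_mem' := ⟨0, 0, I.zero_mem, by simp⟩
      add_mem' := by
        rintro x y ⟨k, a, ha, hx⟩ ⟨l, b, hb, hy⟩
        refine ⟨k + l, ϖ ^ l * a + ϖ ^ k * b,
          I.add_mem (I.mul_mem_left _ ha) (I.mul_mem_left _ hb), ?_⟩
        push_cast
        rw [← hx, ← hy, ← mul_assoc, ← mul_assoc, ← pow_add, ← pow_add, add_comm l k, mul_add]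
      smul_mem' := by
        rintro b x ⟨k, a, ha, hx⟩
        obtain ⟨l, hl⟩ := hA b
        refine ⟨l + k, ⟨_, hl⟩ * a, I.mul_mem_left _ ha, ?_⟩
        push_cast
        rw [← hx, smul_eq_mul, pow_add, mul_assoc, ← mul_assoc _ b x, hcp k b]
        simp only [mul_assoc] }
  obtain ⟨e, hidem, he⟩ := IsSemisimpleRing.ideal_eq_span_idempotent FI
  have heF : e ∈ FI := he ▸ Ideal.mem_span_singleton_self e
  have hIe : ∀ a ∈ I, (a : B) * e = a := fun a ha => by
    have h : (a : B) ∈ FI := ⟨0, a, ha, by simp⟩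
    rw [he] at h
    obtain ⟨r, hr⟩ := Ideal.mem_span_singleton'.1 h
    rw [← hr, mul_assoc, hidem.eq]
  let L : Ideal A :=
    { carrier := {a | ∃ i ∈ I, (a : B) * e = i}
      zero_mem' := ⟨0, I.zero_mem, by simp⟩
      add_mem' := by
        rintro x y ⟨a, ha, hx⟩ ⟨b, hb, hy⟩
        exact ⟨a + b, I.add_mem ha hb, by push_cast; rw [← hx, ← hy, add_mul]⟩
      smul_mem' := by
        rintro b x ⟨a, ha, hx⟩
        exact ⟨b * a, I.mul_mem_left _ ha, by rw [smul_eq_mul]; push_cast; rw [← hx, mul_assoc]⟩ }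
  obtain ⟨k, a, ha, hk⟩ := heF
  have := hL L k ⟨a, ha, by push_cast; exact hk⟩
  choose φ hφI hφ using fun l : L => l.2
  let φ' : L →ₗ[A] I :=
    { toFun := fun l => ⟨φ l, hφI l⟩
      map_add' := fun x y => Subtype.ext (Subtype.ext (by
        rw [← hφ]; push_cast; rw [← hφ, ← hφ, add_mul]))
      map_smul' := fun r y => Subtype.ext (Subtype.ext (by
        rw [← hφ]
        simp only [RingHom.id_apply, Submodule.coe_smul, smul_eq_mul, Subring.coe_mul]
        rw [← hφ, mul_assoc])) }
  refine Module.Projective.of_split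
    (Submodule.inclusion fun a ha => ⟨a, ha, hIe a ha⟩ : I →ₗ[A] L) φ'
    (LinearMap.ext fun a => Subtype.ext (Subtype.ext ?_))
  exact (hφ _).symm.trans (hIe a a.2)

theorem Module.Projective.forall_ideal_of_ringEquiv {R' : Type*} [Ring R'] (e : R ≃+* R')
    (h : ∀ I : Ideal R, Module.Projective R I) (I : Ideal R') : Module.Projective R' I := by
  have := h (I.comap e)
  let e' : I.comap e ≃+ I :=
    { toFun := fun x => ⟨e x, x.2⟩
      invFun := fun y => ⟨e.symm y, Ideal.mem_comap.2 (by simp)⟩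
      left_inv := fun x => by simp
      right_inv := fun x => by simp
      map_add' := fun x y => Subtype.ext (by simp) }
  have : RingHomInvPair (e : R →+* R') (e.symm : R' →+* R) := RingHomInvPair.of_ringEquiv e
  have : RingHomInvPair (e.symm : R' →+* R) (e : R →+* R') := RingHomInvPair.of_ringEquiv e.symm
  exact Module.Projective.of_equiv (σ := (e : R →+* R')) (σ' := (e.symm : R' →+* R))
    { e' with map_smul' := fun r x => Subtype.ext (by simp [e']) }

end HereditaryCriterion

/-! ### The unramified integral closure -/

section GaloisAction

variable (V : Type*) {F K : Type*} [CommRing V] [IsDomain V] [IsDiscreteValuationRing V]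
  [Field F] [Algebra V F] [IsFractionRing V F] [Field K] [Algebra F K] [FiniteDimensional F K]
  [Algebra V K] [IsScalarTower V F K]

/-- The action of a Galois automorphism on the integral closure. -/
noncomputable def galAct (σ : Gal(K/F)) : integralClosure V K ≃ₐ[V] integralClosure V K :=
  galRestrict V F K (integralClosure V K) σ

omit [IsDomain V] [IsDiscreteValuationRing V] in
theorem coe_galAct (σ : Gal(K/F)) (s : integralClosure V K) :
    ((galAct V σ s : integralClosure V K) : K) = σ s :=
  algebraMap_galRestrict_apply V σ s

omit [IsDomain V] [IsDiscreteValuationRing V] in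
theorem exists_galAct_sub_ne_zero {σ : Gal(K/F)} (hσ : σ ≠ 1) :
    ∃ c : integralClosure V K, galAct V σ c - c ≠ 0 := by
  by_contra! h
  refine hσ ((galRestrict V F K (integralClosure V K)).injective (AlgEquiv.ext fun c => ?_))
  rw [map_one]
  exact sub_eq_zero.1 (h c)

variable (F K) in
include F in
theorem isDedekindDomain_integralClosure [IsGalois F K] :
    IsDedekindDomain (integralClosure V K) := integralClosure.isDedekindDomain V F K

end GaloisAction

section Unramified

variable {V S : Type*} [CommRing V] [IsDomain V] [IsDiscreteValuationRing V] [CommRing S]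
  [Algebra V S] [IsDedekindDomain S] [Algebra.Unramified V S]

omit [IsDomain V] [IsDiscreteValuationRing V] in
/-- The inertia groups of an unramified algebra vanish: an automorphism that is trivial modulo `M`
is trivial modulo all powers of `M`, by uniqueness of infinitesimal lifts. -/
theorem exists_sub_notMem_of_ne_one (σ : S ≃ₐ[V] S) (hσ : σ ≠ 1) (M : Ideal S) [hM : M.IsMaximal] :
    ∃ c, σ c - c ∉ M := by
  by_contra! h
  have hid : σ.toAlgHom = AlgHom.id V S :=
    Algebra.FormallyUnramified.ext_of_iInf M (Ideal.iInf_pow_eq_bot_of_isDomain M hM.ne_top)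
      fun x => Ideal.Quotient.eq.2 (h x)
  exact hσ (AlgEquiv.ext fun c => AlgHom.congr_fun hid c)

variable {p : V} (hp : Irreducible p)
include hp

omit [IsDedekindDomain S] [Algebra.Unramified V S] in
theorem algebraMap_mem_of_isMaximal [Algebra.IsIntegral V S] (M : Ideal S) [M.IsMaximal] :
    algebraMap V S p ∈ M := by
  have := Ideal.isMaximal_comap_of_isIntegral_of_isMaximal (R := V) M
  have h := IsLocalRing.eq_maximalIdeal this
  rw [← Ideal.mem_comap, h, hp.maximalIdeal_eq]
  exact Ideal.mem_span_singleton_self p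

omit [IsDedekindDomain S] in
theorem isRadical_span_algebraMap : (Ideal.span {algebraMap V S p}).IsRadical := by
  have h := Algebra.FormallyUnramified.isRadical_map_isMaximal (A := V) S
    (IsLocalRing.maximalIdeal V)
  rwa [hp.maximalIdeal_eq, Ideal.map_span, Set.image_singleton] at h

theorem algebraMap_dvd_of_forall_mem [Algebra.IsIntegral V S] [FaithfulSMul V S] (s : S)
    (h : ∀ M : Ideal S, M.IsMaximal → s ∈ M) : algebraMap V S p ∣ s := by
  rw [← Ideal.mem_span_singleton, ← (isRadical_span_algebraMap hp).radical,
    Ideal.radical_eq_sInf, Submodule.mem_sInf]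
  rintro P ⟨hP, hPp⟩
  refine h P (hPp.isMaximal ?_)
  rintro rfl
  exact hp.ne_zero (by simpa using hP)

theorem algebraMap_notMem_sq [FaithfulSMul V S] (M : Ideal S) [hM : M.IsMaximal] :
    algebraMap V S p ∉ M ^ 2 := by
  have h0 : algebraMap V S p ≠ 0 := by simpa using hp.ne_zero
  intro h
  obtain ⟨I, hI⟩ := Ideal.dvd_iff_le.2 ((Ideal.span_singleton_le_iff_mem _).2 h)
  have hMI : M * I ≠ 0 := by
    intro h'
    rw [pow_two, mul_assoc, h', mul_zero] at hI
    exact h0 (by simpa using hI)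
  -- if `(π) = M² I`, then `(M I)² ⊆ (π)`, and `(π)` is a radical ideal
  have hle : M * I ≤ M * (M * I) := by
    rw [← mul_assoc, ← pow_two, ← hI]
    intro x hx
    refine isRadical_span_algebraMap hp ⟨2, ?_⟩
    rw [hI, pow_two x]
    refine (?_ : M * I * (M * I) ≤ M ^ 2 * I) (Ideal.mul_mem_mul hx hx)
    calc M * I * (M * I) = M ^ 2 * I * I := by ring
      _ ≤ M ^ 2 * I := Ideal.mul_le_left
  have heq : M * (M * I) = M * I := le_antisymm Ideal.mul_le_right hle
  exact hM.ne_top (((mul_eq_right₀ hMI).1 heq).trans Ideal.one_eq_top)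

/-- The element `w` lies in all the maximal ideals other than `M`, so that `w M ⊆ (π)`, but not
in `M`. -/
theorem exists_notMem_forall_dvd_mul [Algebra.IsIntegral V S] [FaithfulSMul V S] (M : Ideal S)
    [M.IsMaximal] : ∃ w ∉ M, ∀ m ∈ M, algebraMap V S p ∣ w * m := by
  obtain ⟨I, hI⟩ := Ideal.dvd_iff_le.2
    ((Ideal.span_singleton_le_iff_mem _).2 (algebraMap_mem_of_isMaximal (S := S) hp M))
  have hIM : ¬ I ≤ M := fun h => algebraMap_notMem_sq hp M <|
    (Ideal.span_singleton_le_iff_mem _).1 (hI ▸ pow_two M ▸ Ideal.mul_mono_right h)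
  obtain ⟨w, hw, hwM⟩ := SetLike.not_le_iff_exists.1 hIM
  refine ⟨w, hwM, fun m hm => Ideal.mem_span_singleton.1 ?_⟩
  rw [hI, mul_comm w]
  exact Ideal.mul_mem_mul hm hw

end Unramified

theorem squarefree_iff_forall_notMem_sq {S : Type*} [CommRing S] [IsDedekindDomain S]
    [IsPrincipalIdealRing S] (s : S) :
    Squarefree s ↔ ∀ M : Ideal S, M.IsMaximal → s ∉ M ^ 2 := by
  constructor
  · intro hs M hM hsM
    obtain ⟨m, rfl⟩ := (IsPrincipalIdealRing.principal M).principal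
    rw [Ideal.submodule_span_eq, Ideal.span_singleton_pow, Ideal.mem_span_singleton, pow_two] at hsM
    exact hM.ne_top (Ideal.span_singleton_eq_top.2 (hs m hsM))
  · intro h x hx
    by_contra hu
    obtain ⟨M, hM, hxM⟩ := exists_max_ideal_of_mem_nonunits hu
    exact h M hM (Ideal.mem_of_dvd _ hx (pow_two M ▸ Ideal.mul_mem_mul hxM hxM))

theorem isPrincipalIdealRing_of_isIntegral (V S : Type*) [CommRing V] [IsDomain V]
    [IsDiscreteValuationRing V] [CommRing S] [Algebra V S] [IsDedekindDomain S]
    [Algebra.IsIntegral V S] [FaithfulSMul V S] : IsPrincipalIdealRing S := by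
  refine IsPrincipalIdealRing.of_finite_maximals
    ((IsDedekindDomain.primesOver_finite (IsLocalRing.maximalIdeal V) (B := S)).subset
      fun M hM => ?_)
  have : M.IsMaximal := hM
  have h := Ideal.isMaximal_comap_of_isIntegral_of_isMaximal (R := V) M
  exact ⟨hM.isPrime, ⟨(IsLocalRing.eq_maximalIdeal h).symm⟩⟩

theorem isArtinian_quotient_span {S : Type*} [CommRing S] [IsDedekindDomain S] {s : S}
    (hs : s ≠ 0) : IsArtinian S (S ⧸ Ideal.span {s}) :=
  (isFiniteLength_iff_isNoetherian_isArtinian.1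
    (isFiniteLength_quotient_span_singleton S (mem_nonZeroDivisors_of_ne_zero hs))).2

/-! ### The crossed-product order and its coefficients -/

theorem Ideal.mem_comap_pow_iff {R S E : Type*} [CommRing R] [CommRing S] [EquivLike E R S]
    [RingEquivClass E R S] (e : E) (I : Ideal S) (n : ℕ) (x : R) :
    x ∈ I.comap e ^ n ↔ e x ∈ I ^ n := by
  have h (J : Ideal S) : J.comap e = J.map (RingEquivClass.toRingEquiv e).symm :=
    (Ideal.map_symm (I := J) (RingEquivClass.toRingEquiv e)).symm
  rw [← Ideal.mem_comap, h, h, Ideal.map_pow]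

section GalAct

variable {V F K : Type*} [CommRing V] [Field F] [Algebra V F] [IsFractionRing V F]
  [Field K] [Algebra F K] [FiniteDimensional F K] [Algebra V K] [IsScalarTower V F K]

@[simp] theorem galAct_one (s : integralClosure V K) : galAct V (1 : Gal(K/F)) s = s := by
  rw [galAct, map_one]; rfl

theorem galAct_mul (σ τ : Gal(K/F)) (s : integralClosure V K) :
    galAct V (σ * τ) s = galAct V σ (galAct V τ s) := by
  rw [galAct, map_mul]; rfl

@[simp] theorem galAct_galAct_inv (σ : Gal(K/F)) (s : integralClosure V K) :
    galAct V σ (galAct V σ⁻¹ s) = s := by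
  rw [← galAct_mul, mul_inv_cancel, galAct_one]

end GalAct

namespace IntegralTwoCocycle

section Order

variable {V F K : Type*} [CommRing V] [Field F] [Algebra V F] [IsFractionRing V F]
  [Field K] [Algebra F K] [FiniteDimensional F K] [Algebra V K] [IsScalarTower V F K]
  (f : IntegralTwoCocycle V F K)

section Values

variable (σ τ ρ : Gal(K/F))

@[simp] theorem coe_val : (f.val σ τ : K) = f.toFun (σ, τ) := rfl

@[simp] theorem val_one_left : f.val 1 σ = 1 := Subtype.ext (by simp [f.map_one_left])

@[simp] theorem val_one_right : f.val σ 1 = 1 := Subtype.ext (by simp [f.map_one_right])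

theorem val_ne_zero : f.val σ τ ≠ 0 := fun h =>
  (f.toFun (σ, τ)).ne_zero (congrArg Subtype.val h)

theorem val_mul_val : f.val (σ * τ) ρ * f.val σ τ = galAct V σ (f.val τ ρ) * f.val σ (τ * ρ) :=
  Subtype.ext (by simpa [coe_galAct] using f.cocycle σ τ ρ)

theorem galAct_val_mul_val :
    galAct V σ (f.val σ⁻¹ ρ) * f.val σ (σ⁻¹ * ρ) = f.val σ σ⁻¹ := by
  simpa using (f.val_mul_val σ σ⁻¹ ρ).symm

theorem galAct_val :
    galAct V σ (f.val (σ⁻¹ * ρ) (ρ⁻¹ * σ)) = f.val σ (σ⁻¹ * ρ) * f.val ρ (ρ⁻¹ * σ) := by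
  have h := f.val_mul_val σ (σ⁻¹ * ρ) (ρ⁻¹ * σ)
  have e : σ⁻¹ * ρ * (ρ⁻¹ * σ) = 1 := by group
  rw [mul_inv_cancel_left, e, val_one_right, mul_one] at h
  rw [← h, mul_comm]

theorem val_dvd_val_inv : f.val σ τ ∣ f.val σ σ⁻¹ :=
  Dvd.intro_left _ (by simpa using f.galAct_val_mul_val σ (σ * τ))

end Values

/-- The preorder `σ ≤ ρ` on the Galois group that belongs to a prime ideal `M`. The elements
`σ ≤ 1` are those with `f(σ, σ⁻¹) ∉ M`. -/
def Le (M : Ideal (integralClosure V K)) (σ ρ : Gal(K/F)) : Prop := f.val σ (σ⁻¹ * ρ) ∉ M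

section Le

variable (M : Ideal (integralClosure V K)) [hM : M.IsPrime]

theorem le_refl (σ : Gal(K/F)) : f.Le M σ σ := by
  simpa [Le] using M.ne_top_iff_one.1 hM.ne_top

theorem one_le (σ : Gal(K/F)) : f.Le M 1 σ := by
  simpa [Le] using M.ne_top_iff_one.1 hM.ne_top

variable {M}

theorem Le.trans {σ ρ κ : Gal(K/F)} (h₁ : f.Le M σ ρ) (h₂ : f.Le M ρ κ) : f.Le M σ κ := by
  have h := f.val_mul_val σ (σ⁻¹ * ρ) (ρ⁻¹ * κ)
  have e : σ⁻¹ * ρ * (ρ⁻¹ * κ) = σ⁻¹ * κ := by group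
  rw [mul_inv_cancel_left, e] at h
  exact fun h' => (hM.mem_or_mem (h ▸ M.mul_mem_left _ h')).elim h₂ h₁

/-- Equivalence for `M` of two group elements, expressed through the conjugate `σ⁻¹(M)`. -/
theorem le_comap_iff (σ ρ : Gal(K/F)) :
    f.Le (M.comap (galAct V σ)) (σ⁻¹ * ρ) 1 ↔ f.Le M σ ρ ∧ f.Le M ρ σ := by
  simp only [Le, mul_one, mul_inv_rev, inv_inv, Ideal.mem_comap]
  rw [f.galAct_val, hM.mul_mem_iff_mem_or_mem, not_or]

theorem le_total (hf : ∀ σ τ, ∀ N : Ideal (integralClosure V K), N.IsMaximal → f.val σ τ ∉ N ^ 2)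
    [M.IsMaximal] (σ ρ : Gal(K/F)) : f.Le M σ ρ ∨ f.Le M ρ σ := by
  by_contra! h
  have hN := Ideal.comap_isMaximal_of_equiv (galAct V σ) (p := M)
  refine hf (σ⁻¹ * ρ) (ρ⁻¹ * σ) _ hN ?_
  rw [Ideal.mem_comap_pow_iff, f.galAct_val, pow_two]
  exact Ideal.mul_mem_mul (not_not.1 h.1) (not_not.1 h.2)

end Le

/-- The coefficient of `x_σ`, as an element of the integral closure. -/
def coeff (a : f.crossedProductOrder) (σ : Gal(K/F)) : integralClosure V K := ⟨a.1 σ, a.2 σ⟩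

variable {f} in
theorem order_ext {a b : f.crossedProductOrder} (h : ∀ σ, f.coeff a σ = f.coeff b σ) : a = b :=
  Subtype.ext (funext fun σ => congrArg Subtype.val (h σ))

@[simp] theorem coeff_zero (σ : Gal(K/F)) : f.coeff 0 σ = 0 := rfl

@[simp] theorem coeff_add (a b : f.crossedProductOrder) (σ : Gal(K/F)) :
    f.coeff (a + b) σ = f.coeff a σ + f.coeff b σ := rfl

@[simp] theorem coeff_neg (a : f.crossedProductOrder) (σ : Gal(K/F)) :
    f.coeff (-a) σ = -f.coeff a σ := rfl

@[simp] theorem coeff_sub (a b : f.crossedProductOrder) (σ : Gal(K/F)) :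
    f.coeff (a - b) σ = f.coeff a σ - f.coeff b σ := by
  rw [sub_eq_add_neg, coeff_add, coeff_neg, sub_eq_add_neg]

theorem coeff_sum {ι : Type*} (s : Finset ι) (a : ι → f.crossedProductOrder) (σ : Gal(K/F)) :
    f.coeff (∑ i ∈ s, a i) σ = ∑ i ∈ s, f.coeff (a i) σ := by
  classical
  induction s using Finset.induction_on with
  | empty => simp
  | insert i s hi ih => simp [Finset.sum_insert hi, ih]

theorem coeff_mul (a b : f.crossedProductOrder) (ρ : Gal(K/F)) :
    f.coeff (a * b) ρ =
      ∑ σ, f.coeff a σ * galAct V σ (f.coeff b (σ⁻¹ * ρ)) * f.val σ (σ⁻¹ * ρ) := by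
  refine Subtype.ext ?_
  simp only [AddSubmonoidClass.coe_finsetSum, MulMemClass.coe_mul, coe_galAct]
  exact CrossedProduct.mul_apply a.1 b.1 ρ

open Classical in
/-- The element `s x_σ`. -/
noncomputable def monomial (σ : Gal(K/F)) (s : integralClosure V K) : f.crossedProductOrder :=
  ⟨fun τ => if τ = σ then (s : K) else 0, fun τ => by
    dsimp only
    split_ifs
    · exact s.2
    · exact zero_mem _⟩

open Classical in
theorem coeff_monomial (σ τ : Gal(K/F)) (s : integralClosure V K) :
    f.coeff (f.monomial σ s) τ = if τ = σ then s else 0 :=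
  Subtype.ext (by simp only [coeff, monomial]; split_ifs <;> rfl)

@[simp] theorem coeff_monomial_same (σ : Gal(K/F)) (s : integralClosure V K) :
    f.coeff (f.monomial σ s) σ = s := by simp [coeff_monomial]

theorem coeff_monomial_mul (σ ρ : Gal(K/F)) (s : integralClosure V K) (a : f.crossedProductOrder) :
    f.coeff (f.monomial σ s * a) ρ =
      s * galAct V σ (f.coeff a (σ⁻¹ * ρ)) * f.val σ (σ⁻¹ * ρ) := by
  rw [coeff_mul, Finset.sum_eq_single σ]
  · simp
  · intro τ _ h
    simp [coeff_monomial, h]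
  · simp

theorem coeff_mul_monomial (σ ρ : Gal(K/F)) (s : integralClosure V K) (a : f.crossedProductOrder) :
    f.coeff (a * f.monomial σ s) ρ =
      f.coeff a (ρ * σ⁻¹) * galAct V (ρ * σ⁻¹) s * f.val (ρ * σ⁻¹) σ := by
  rw [coeff_mul, Finset.sum_eq_single (ρ * σ⁻¹)]
  · simp
  · intro τ _ h
    have : τ⁻¹ * ρ ≠ σ := fun h' => h (by rw [← h']; group)
    simp [coeff_monomial, this]
  · simp

theorem coeff_one (σ : Gal(K/F)) : f.coeff 1 σ = f.coeff (f.monomial 1 1) σ := by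
  classical
  rw [coeff_monomial]
  refine Subtype.ext ((CrossedProduct.one_apply f σ).trans ?_)
  split_ifs <;> rfl

/-- The embedding `s ↦ s x_1` of the integral closure into the order. -/
noncomputable def scalar : integralClosure V K →+* f.crossedProductOrder where
  toFun := f.monomial 1
  map_one' := order_ext fun σ => (f.coeff_one σ).symm
  map_zero' := order_ext fun σ => by simp [coeff_monomial]
  map_add' s t := order_ext fun σ => by
    simp only [coeff_monomial, coeff_add]; split_ifs <;> simp
  map_mul' s t := order_ext fun σ => by
    rw [coeff_monomial_mul]
    simp [coeff_monomial]

theorem coeff_scalar_mul (s : integralClosure V K) (a : f.crossedProductOrder) (σ : Gal(K/F)) :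
    f.coeff (f.scalar s * a) σ = s * f.coeff a σ := by
  simpa using! f.coeff_monomial_mul 1 σ s a

theorem coeff_mul_scalar (s : integralClosure V K) (a : f.crossedProductOrder) (σ : Gal(K/F)) :
    f.coeff (a * f.scalar s) σ = f.coeff a σ * galAct V σ s := by
  simpa using! f.coeff_mul_monomial 1 σ s a

theorem monomial_mul_monomial (σ τ : Gal(K/F)) (s t : integralClosure V K) :
    f.monomial σ s * f.monomial τ t = f.monomial (σ * τ) (s * galAct V σ t * f.val σ τ) := by
  refine order_ext fun ρ => ?_
  rw [coeff_monomial_mul, coeff_monomial, coeff_monomial]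
  by_cases h : ρ = σ * τ
  · simp [h]
  · have : ¬ σ⁻¹ * ρ = τ := fun h' => h (by rw [← h']; group)
    simp [h, this]

theorem coeff_sum_monomial (c : Gal(K/F) → integralClosure V K) (τ : Gal(K/F)) :
    f.coeff (∑ σ, f.monomial σ (c σ)) τ = c τ := by
  classical
  rw [coeff_sum, Finset.sum_eq_single τ] <;> simp +contextual [coeff_monomial, eq_comm]

theorem sum_monomial_coeff (a : f.crossedProductOrder) : ∑ σ, f.monomial σ (f.coeff a σ) = a :=
  order_ext fun τ => f.coeff_sum_monomial _ τ

theorem scalar_algebraMap_mul (v : V) (a : f.crossedProductOrder) :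
    f.scalar (algebraMap V _ v) * a = a * f.scalar (algebraMap V _ v) :=
  order_ext fun σ => by rw [coeff_scalar_mul, coeff_mul_scalar, AlgEquiv.commutes, mul_comm]

theorem exists_mul_scalar_iff (v : V) (a : f.crossedProductOrder) :
    (∃ b, b * f.scalar (algebraMap V _ v) = a) ↔ ∀ σ, algebraMap V _ v ∣ f.coeff a σ := by
  constructor
  · rintro ⟨b, rfl⟩ σ
    rw [← scalar_algebraMap_mul, coeff_scalar_mul]
    exact dvd_mul_right _ _
  · intro h
    choose c hc using h
    refine ⟨∑ σ, f.monomial σ (c σ), order_ext fun σ => ?_⟩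
    rw [← scalar_algebraMap_mul, coeff_scalar_mul, hc, coeff_sum_monomial]

end Order

end IntegralTwoCocycle

/-! ### The radical of the order -/

namespace IntegralTwoCocycle

section Radical

variable {V F K : Type*} [CommRing V] [Field F] [Algebra V F] [IsFractionRing V F]
  [Field K] [Algebra F K] [FiniteDimensional F K] [Algebra V K] [IsScalarTower V F K]
  (f : IntegralTwoCocycle V F K)

/-- The ideal of all `∑ s_σ x_σ` such that `s_σ` lies in every maximal ideal `M` for which `σ ≤ 1`.
It is stated as a left ideal; it is two-sided, and it is the Jacobson radical of the order. -/
def radIdeal : Ideal f.crossedProductOrder where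
  carrier := {a | ∀ (σ : Gal(K/F)) (M : Ideal (integralClosure V K)), M.IsMaximal →
    f.Le M σ 1 → f.coeff a σ ∈ M}
  zero_mem' _ M _ _ := M.zero_mem
  add_mem' ha hb σ M hM h := M.add_mem (ha σ M hM h) (hb σ M hM h)
  smul_mem' b t ht ρ M hM h := by
    rw [smul_eq_mul, coeff_mul]
    refine M.sum_mem fun σ _ => ?_
    by_cases hle : f.Le M σ ρ
    · have hN := Ideal.comap_isMaximal_of_equiv (galAct V σ) (p := M)
      exact M.mul_mem_right _ (M.mul_mem_left _
        (ht _ _ hN ((f.le_comap_iff σ ρ).2 ⟨hle, h.trans f (f.one_le M σ)⟩)))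
    · exact M.mul_mem_left _ (not_not.1 hle)

variable {f}

theorem coeff_mem_of_mem_radIdeal {t : f.crossedProductOrder} (ht : t ∈ f.radIdeal)
    {M : Ideal (integralClosure V K)} [hM : M.IsMaximal] {σ : Gal(K/F)} (h : f.Le M σ 1) :
    f.coeff t σ ∈ M := ht σ M hM h

theorem galAct_coeff_mem_of_mem_radIdeal {t : f.crossedProductOrder} (ht : t ∈ f.radIdeal)
    {M : Ideal (integralClosure V K)} [hM : M.IsMaximal] {σ ρ : Gal(K/F)} (h : f.Le M σ ρ)
    (h' : f.Le M ρ σ) : galAct V σ (f.coeff t (σ⁻¹ * ρ)) ∈ M :=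
  have hN := Ideal.comap_isMaximal_of_equiv (galAct V σ) (p := M)
  ht _ _ hN ((f.le_comap_iff σ ρ).2 ⟨h, h'⟩)

instance : f.radIdeal.IsTwoSided where
  mul_mem_of_left b ht ρ M hM h := by
    rw [coeff_mul]
    refine M.sum_mem fun σ _ => ?_
    by_cases hle : f.Le M σ ρ
    · exact M.mul_mem_right _ (M.mul_mem_right _
        (coeff_mem_of_mem_radIdeal ht (hle.trans f h)))
    · exact M.mul_mem_left _ (not_not.1 hle)

variable (f) in
open Classical in
/-- The number of group elements that are strictly smaller than `ρ` for `M`. -/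
noncomputable def height (M : Ideal (integralClosure V K)) (ρ : Gal(K/F)) : ℕ :=
  (Finset.univ.filter fun κ => f.Le M κ ρ ∧ ¬ f.Le M ρ κ).card

theorem height_lt {M : Ideal (integralClosure V K)} [M.IsMaximal] {σ ρ : Gal(K/F)}
    (h : f.Le M σ ρ) (h' : ¬ f.Le M ρ σ) : f.height M σ < f.height M ρ := by
  classical
  refine Finset.card_lt_card (Finset.ssubset_iff_of_subset (fun κ hκ => ?_) |>.2 ⟨σ, ?_, ?_⟩)
  · simp only [Finset.mem_filter, Finset.mem_univ, true_and] at hκ ⊢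
    exact ⟨hκ.1.trans f h, fun h'' => h' (h''.trans f hκ.1)⟩
  · simpa using ⟨h, h'⟩
  · simp

/-- Multiplication by an element of `radIdeal` raises, modulo `M`, the height of the support. -/
theorem coeff_pow_mem {t : f.crossedProductOrder} (ht : t ∈ f.radIdeal)
    (M : Ideal (integralClosure V K)) [M.IsMaximal] (k : ℕ) (ρ : Gal(K/F))
    (hk : f.height M ρ < k) : f.coeff (t ^ k) ρ ∈ M := by
  induction k generalizing ρ with
  | zero => omega
  | succ k ih =>
    rw [pow_succ, coeff_mul]
    refine M.sum_mem fun σ _ => ?_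
    by_cases h : f.Le M σ ρ
    · refine M.mul_mem_right _ ?_
      by_cases h' : f.Le M ρ σ
      · exact M.mul_mem_left _ (galAct_coeff_mem_of_mem_radIdeal ht h h')
      · exact M.mul_mem_right _ (ih σ (by have := height_lt h h'; omega))
    · exact M.mul_mem_left _ (not_not.1 h)

theorem exists_pow_coeff_mem {t : f.crossedProductOrder} (ht : t ∈ f.radIdeal) :
    ∃ k : ℕ, ∀ (σ : Gal(K/F)) (M : Ideal (integralClosure V K)), M.IsMaximal →
      f.coeff (t ^ k) σ ∈ M := by
  classical
  exact ⟨Fintype.card Gal(K/F) + 1, fun σ M hM => coeff_pow_mem ht M _ _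
    (Nat.lt_succ_of_le (Finset.card_le_univ _))⟩

/-- If every `σ ≠ 1` acts nontrivially modulo the prime `P`, then the twisted scalar actions on the
components `S x_σ` can be told apart, and a two-sided ideal that contains an element whose
coefficient at `σ` is not in `P` contains such an element of the form `s x_σ`. -/
theorem exists_monomial_mem (P : Ideal (integralClosure V K)) [hP : P.IsPrime]
    (hsep : ∀ σ : Gal(K/F), σ ≠ 1 → ∃ c, galAct V σ c - c ∉ P) (N : Ideal f.crossedProductOrder)
    [N.IsTwoSided] {a : f.crossedProductOrder} (ha : a ∈ N) {σ : Gal(K/F)}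
    (hσ : f.coeff a σ ∉ P) : ∃ s ∉ P, f.monomial σ s ∈ N := by
  classical
  have key (Z : Finset Gal(K/F)) (hZ : σ ∉ Z) :
      ∃ b ∈ N, f.coeff b σ ∉ P ∧ ∀ τ ∈ Z, f.coeff b τ = 0 := by
    induction Z using Finset.induction_on with
    | empty => exact ⟨a, ha, hσ, by simp⟩
    | insert τ Z hτ ih =>
      rw [Finset.mem_insert, not_or] at hZ
      obtain ⟨b, hbN, hbσ, hbZ⟩ := ih hZ.2
      obtain ⟨c, hc⟩ := hsep (σ * τ⁻¹) (fun h => hZ.1 (mul_inv_eq_one.1 h))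
      -- right and left multiplication by scalars differ by `σ(d) - τ(d)` on the coefficient at `σ`
      set d := galAct V τ⁻¹ c with hd
      have hcoeff (κ : Gal(K/F)) : f.coeff (b * f.scalar d - f.scalar c * b) κ =
          f.coeff b κ * (galAct V (κ * τ⁻¹) c - c) := by
        rw [coeff_sub, coeff_mul_scalar, coeff_scalar_mul, hd, galAct_mul]
        ring
      refine ⟨b * f.scalar d - f.scalar c * b,
        N.sub_mem (N.mul_mem_right _ hbN) (N.mul_mem_left _ hbN), ?_, fun κ hκ => ?_⟩
      · rw [hcoeff]
        exact fun h => (hP.mem_or_mem h).elim hbσ hc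
      · rw [hcoeff]
        obtain rfl | hκ := Finset.mem_insert.1 hκ
        · simp
        · rw [hbZ κ hκ, zero_mul]
  obtain ⟨b, hbN, hbσ, hb⟩ := key (Finset.univ.erase σ) (by simp)
  refine ⟨_, hbσ, ?_⟩
  have hmon : f.monomial σ (f.coeff b σ) = b := order_ext fun τ => by
    rw [coeff_monomial]
    split_ifs with h
    · rw [h]
    · exact (hb τ (by simpa using h)).symm
  exact hmon.symm ▸ hbN

end Radical

end IntegralTwoCocycle

theorem faithfulSMul_integralClosure (V F K : Type*) [CommRing V] [Field F] [Algebra V F]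
    [IsFractionRing V F] [Field K] [Algebra F K] [Algebra V K] [IsScalarTower V F K] :
    FaithfulSMul V (integralClosure V K) := by
  rw [faithfulSMul_iff_algebraMap_injective]
  have h : Function.Injective (algebraMap V K) := by
    rw [IsScalarTower.algebraMap_eq V F K]
    exact (algebraMap F K).injective.comp (IsFractionRing.injective V F)
  exact fun x y hxy => h (congrArg Subtype.val hxy)

/-! ### Finiteness and semisimplicity -/

namespace IntegralTwoCocycle

section Finiteness

variable {V F K : Type*} [CommRing V] [Field F] [Algebra V F] [IsFractionRing V F]
  [Field K] [Algebra F K] [FiniteDimensional F K] [Algebra V K] [IsScalarTower V F K]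
  (f : IntegralTwoCocycle V F K)

/-- Left multiplication by the scalars `s x_1`. -/
noncomputable instance : Module (integralClosure V K) f.crossedProductOrder :=
  Module.compHom _ f.scalar

theorem smul_def (s : integralClosure V K) (a : f.crossedProductOrder) :
    s • a = f.scalar s * a := rfl

instance : IsScalarTower (integralClosure V K) f.crossedProductOrder f.crossedProductOrder :=
  ⟨fun s a b => mul_assoc (f.scalar s) a b⟩

/-- The order is free over the integral closure, with basis the `x_σ`. -/
noncomputable def coeffEquiv : f.crossedProductOrder ≃ₗ[integralClosure V K]
    (Gal(K/F) → integralClosure V K) where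
  toFun := f.coeff
  invFun c := ∑ σ, f.monomial σ (c σ)
  map_add' a b := funext fun σ => f.coeff_add a b σ
  map_smul' s a := funext fun σ => f.coeff_scalar_mul s a σ
  left_inv a := f.sum_monomial_coeff a
  right_inv c := funext fun σ => f.coeff_sum_monomial c σ

theorem isNoetherianRing [IsNoetherianRing (integralClosure V K)] :
    IsNoetherianRing f.crossedProductOrder :=
  have : IsNoetherian (integralClosure V K) f.crossedProductOrder :=
    isNoetherian_of_linearEquiv f.coeffEquiv.symm
  isNoetherian_of_tower (integralClosure V K) this

theorem isArtinian_quotient [IsDedekindDomain (integralClosure V K)]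
    (L : Ideal f.crossedProductOrder) {s : integralClosure V K} (hs : s ≠ 0)
    (hL : ∀ a, s • a ∈ L) : IsArtinian f.crossedProductOrder (f.crossedProductOrder ⧸ L) := by
  have := isArtinian_quotient_span hs
  let q : f.crossedProductOrder →ₗ[integralClosure V K] f.crossedProductOrder ⧸ L :=
    L.mkQ.restrictScalars _
  let ψ : (Gal(K/F) → integralClosure V K ⧸ Ideal.span {s}) →ₗ[integralClosure V K]
      f.crossedProductOrder ⧸ L :=
    ∑ σ, ((Ideal.span {s}).liftQ (q.comp
      (LinearMap.toSpanSingleton (integralClosure V K) _ (f.monomial σ 1))) (by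
        rw [Ideal.span, Submodule.span_le, Set.singleton_subset_iff]
        exact (Submodule.Quotient.mk_eq_zero L).2 (hL _))).comp (LinearMap.proj σ)
  have hψ : Function.Surjective ψ := fun x => by
    obtain ⟨a, rfl⟩ := L.mkQ_surjective x
    refine ⟨fun σ => Submodule.Quotient.mk (f.coeff a σ), ?_⟩
    conv_rhs => rw [← f.sum_monomial_coeff a, map_sum]
    simp only [ψ, LinearMap.sum_apply, LinearMap.comp_apply, LinearMap.proj_apply]
    refine Finset.sum_congr rfl fun σ _ => congrArg L.mkQ ?_
    rw [LinearMap.toSpanSingleton_apply, smul_def]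
    exact order_ext fun τ => by simp [coeff_scalar_mul, coeff_monomial]
  have h : IsArtinian (integralClosure V K) (f.crossedProductOrder ⧸ L) :=
    isArtinian_of_surjective _ ψ hψ
  exact isArtinian_of_tower (integralClosure V K) h

end Finiteness

section Algebra

variable {V F K : Type*} [CommRing V] [IsDomain V] [IsDiscreteValuationRing V]
  [Field F] [Algebra V F] [IsFractionRing V F]
  [Field K] [Algebra F K] [FiniteDimensional F K] [Algebra V K] [IsScalarTower V F K]
  (f : IntegralTwoCocycle V F K)

/-- The coefficientwise action, which is left multiplication by `K x_1`. -/
noncomputable instance : Module K f.CrossedProduct := inferInstanceAs (Module K (Gal(K/F) → K))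

theorem smul_apply (x : K) (b : f.CrossedProduct) (σ : Gal(K/F)) : (x • b) σ = x * b σ := rfl

instance : IsScalarTower K f.CrossedProduct f.CrossedProduct :=
  ⟨fun x a b => CrossedProduct.ext fun ρ => by
    simp only [smul_eq_mul, smul_apply, CrossedProduct.mul_apply, Finset.mul_sum, mul_assoc]⟩

theorem coe_scalar (s : integralClosure V K) :
    (f.scalar s : f.CrossedProduct) = (s : K) • (1 : f.CrossedProduct) :=
  CrossedProduct.ext fun σ => by
    rw [smul_apply, CrossedProduct.one_apply]
    change (f.coeff (f.monomial 1 s) σ : K) = _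
    rw [coeff_monomial]
    split_ifs <;> simp

theorem coe_scalar_mul (s : integralClosure V K) (b : f.CrossedProduct) :
    (f.scalar s : f.CrossedProduct) * b = (s : K) • b := by
  rw [coe_scalar, smul_mul_assoc, one_mul]

theorem mul_coe_scalar_algebraMap (v : V) (b : f.CrossedProduct) :
    b * (f.scalar (algebraMap V _ v) : f.CrossedProduct) = (algebraMap V K v : K) • b := by
  classical
  refine CrossedProduct.ext fun ρ => ?_
  rw [CrossedProduct.mul_apply, Finset.sum_eq_single ρ, smul_apply]
  · rw [inv_mul_cancel, coe_scalar, smul_apply, CrossedProduct.one_apply, f.map_one_right]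
    simp [IsScalarTower.algebraMap_apply V F K, mul_comm]
  · intro σ _ h
    have : ¬ σ⁻¹ * ρ = 1 := fun h' => h (inv_mul_eq_one.1 h')
    simp [coe_scalar, smul_apply, CrossedProduct.one_apply, this]
  · simp

variable (F) in
include F in
theorem exists_pow_mul_mem_integralClosure {p : V} (hp : Irreducible p) (x : K) :
    ∃ k : ℕ, algebraMap V K p ^ k * x ∈ integralClosure V K := by
  have hx : IsAlgebraic V x := (IsFractionRing.isAlgebraic_iff V F K).2 (.of_finite F x)
  obtain ⟨v, hv, hvx⟩ := hx.exists_integral_multiple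
  obtain ⟨n, u, rfl⟩ := IsDiscreteValuationRing.eq_unit_mul_pow_irreducible hv hp
  refine ⟨n, ?_⟩
  have h := (integralClosure V K).smul_mem hvx (↑u⁻¹ : V)
  rw [smul_smul, Units.inv_mul_cancel_left, Algebra.smul_def, map_pow] at h
  exact h

theorem exists_pow_mul_mem_order {p : V} (hp : Irreducible p) (b : f.CrossedProduct) :
    ∃ k : ℕ, (f.scalar (algebraMap V _ p) : f.CrossedProduct) ^ k * b ∈ f.crossedProductOrder := by
  classical
  choose k hk using fun σ => exists_pow_mul_mem_integralClosure F hp (b σ)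
  refine ⟨∑ σ, k σ, fun σ => ?_⟩
  rw [← Subring.coe_pow, ← map_pow, coe_scalar_mul, smul_apply, ← map_pow,
    ← Finset.sum_erase_add _ _ (Finset.mem_univ σ), pow_add, map_mul, MulMemClass.coe_mul,
    mul_assoc]
  refine mul_mem (SetLike.coe_mem _) ?_
  simpa using hk σ

theorem isSemisimpleRing_crossedProduct : IsSemisimpleRing f.CrossedProduct := by
  have : IsArtinianRing f.CrossedProduct :=
    isArtinian_of_tower K (inferInstanceAs (IsArtinian K (Gal(K/F) → K)))
  have : Nontrivial f.CrossedProduct := inferInstanceAs (Nontrivial (Gal(K/F) → K))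
  rw [IsArtinianRing.isSemisimpleRing_iff_jacobson]
  by_contra hJ
  obtain ⟨b, hb, hb0⟩ := Submodule.exists_mem_ne_zero_of_ne_bot hJ
  obtain ⟨p, hp⟩ := IsDiscreteValuationRing.exists_irreducible V
  obtain ⟨k, hk⟩ := f.exists_pow_mul_mem_order hp b
  let N : Ideal f.crossedProductOrder := (Ring.jacobson f.CrossedProduct).comap
    f.crossedProductOrder.subtype
  obtain ⟨σ, hσ⟩ : ∃ σ, b σ ≠ 0 := by
    by_contra! h
    exact hb0 (CrossedProduct.ext h)
  have hp0 : algebraMap V K p ≠ 0 := by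
    rw [IsScalarTower.algebraMap_apply V F K, map_ne_zero]
    simpa using hp.ne_zero
  obtain ⟨s, hs, hsN⟩ := f.exists_monomial_mem ⊥ (σ := σ)
    (fun τ hτ => by simpa using exists_galAct_sub_ne_zero V hτ) N
    (a := ⟨_, hk⟩) (Ideal.mul_mem_left _ _ hb) (by
      rw [Ideal.mem_bot]
      intro h
      have h' := congrArg Subtype.val h
      change ((f.scalar (algebraMap V _ p) : f.CrossedProduct) ^ k * b) σ = 0 at h'
      rw [← Subring.coe_pow, ← map_pow, coe_scalar_mul, smul_apply] at h'
      simp [hp0, hσ] at h')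
  -- `x_{σ⁻¹} s x_σ` is a nonzero scalar, hence a unit of the crossed product
  have hu := N.mul_mem_left (f.monomial σ⁻¹ 1) hsN
  rw [monomial_mul_monomial, inv_mul_cancel, one_mul] at hu
  set u := galAct V σ⁻¹ s * f.val σ⁻¹ σ
  have hu0 : (u : K) ≠ 0 := fun h => (mul_ne_zero (by simpa using hs) (f.val_ne_zero σ⁻¹ σ))
    (Subtype.ext h : u = 0)
  have h1 := Submodule.smul_of_tower_mem (Ring.jacobson f.CrossedProduct) (u : K)⁻¹
    (show (f.scalar u : f.CrossedProduct) ∈ _ from hu)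
  rw [coe_scalar, smul_smul, inv_mul_cancel₀ hu0, one_smul] at h1
  exact (Ring.jacobson_lt_top _).ne ((Ideal.eq_top_iff_one _).2 h1)

end Algebra

section Quotient

variable {V F K : Type*} [CommRing V] [IsDomain V] [IsDiscreteValuationRing V]
  [Field F] [Algebra V F] [IsFractionRing V F]
  [Field K] [Algebra F K] [FiniteDimensional F K] [Algebra V K] [IsScalarTower V F K]
  [IsDedekindDomain (integralClosure V K)] [FaithfulSMul V (integralClosure V K)]
  [Algebra.Unramified V (integralClosure V K)]
  (f : IntegralTwoCocycle V F K)

theorem exists_galAct_sub_notMem (M : Ideal (integralClosure V K)) [M.IsMaximal] (σ : Gal(K/F))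
    (hσ : σ ≠ 1) : ∃ c, galAct V σ c - c ∉ M :=
  exists_sub_notMem_of_ne_one _
    (fun h => hσ ((galRestrict V F K (integralClosure V K)).injective (h.trans (map_one _).symm))) M

theorem isSemisimpleRing_quotient_radIdeal :
    IsSemisimpleRing (f.crossedProductOrder ⧸ f.radIdeal) := by
  obtain ⟨p, hp⟩ := IsDiscreteValuationRing.exists_irreducible V
  have h0 : algebraMap V (integralClosure V K) p ≠ 0 := by simpa using hp.ne_zero
  have h := f.isArtinian_quotient f.radIdeal h0 fun a σ M hM _ => by
    rw [smul_def, coeff_scalar_mul]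
    exact M.mul_mem_right _ (algebraMap_mem_of_isMaximal hp M)
  have : IsArtinianRing (f.crossedProductOrder ⧸ f.radIdeal) :=
    isArtinian_of_tower f.crossedProductOrder h
  rw [IsArtinianRing.isSemisimpleRing_iff_jacobson, eq_bot_iff]
  intro x hx
  obtain ⟨a, rfl⟩ := Ideal.Quotient.mk_surjective x
  rw [Ideal.mem_bot, Ideal.Quotient.eq_zero_iff_mem]
  intro σ M hM hle
  by_contra haM
  let N : Ideal f.crossedProductOrder := (Ring.jacobson _).comap (Ideal.Quotient.mk f.radIdeal)
  obtain ⟨s, hs, hsN⟩ := f.exists_monomial_mem M (exists_galAct_sub_notMem M) N hx haM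
  -- `s x_σ x_{σ⁻¹}` is a scalar outside `M`, hence not nilpotent modulo `radIdeal`
  have hy := N.mul_mem_right (f.monomial σ⁻¹ 1) hsN
  rw [monomial_mul_monomial, mul_inv_cancel, map_one, mul_one] at hy
  set y := s * f.val σ σ⁻¹
  have hyM : y ∉ M := fun h => (hM.isPrime.mem_or_mem h).elim hs (by simpa [Le] using hle)
  obtain ⟨k, hk⟩ := IsSemiprimaryRing.isNilpotent (R := f.crossedProductOrder ⧸ f.radIdeal)
  have hyk := Ideal.pow_mem_pow (show Ideal.Quotient.mk f.radIdeal (f.scalar y) ∈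
    Ring.jacobson _ from hy) k
  rw [hk, ← map_pow, ← map_pow] at hyk
  have := coeff_mem_of_mem_radIdeal (Ideal.Quotient.eq_zero_iff_mem.1 hyk) (f.le_refl M 1)
  exact hyM (hM.isPrime.mem_of_pow_mem k ((f.coeff_monomial_same 1 (y ^ k)) ▸ this))

/-- The element `π` lies in `N` by Nakayama's lemma, and `radIdeal` consists of elements that are
nilpotent modulo `π`. -/
theorem radIdeal_le_of_isMaximal (N : Ideal f.crossedProductOrder) (hN : N.IsMaximal) :
    f.radIdeal ≤ N := by
  obtain ⟨p, hp⟩ := IsDiscreteValuationRing.exists_irreducible V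
  set π := algebraMap V (integralClosure V K) p
  have hπ : f.scalar π ∈ N := by
    by_contra h
    obtain ⟨n, hn, r, hr⟩ : ∃ n ∈ N, ∃ r, n + r * f.scalar π = 1 := by
      have := hN.1.2 (N ⊔ Ideal.span {f.scalar π}) (lt_of_le_of_ne le_sup_left fun h' =>
        h (h' ▸ Submodule.mem_sup_right (Ideal.mem_span_singleton_self _)))
      obtain ⟨n, hn, m, hm, hnm⟩ := Submodule.mem_sup.1 ((Ideal.eq_top_iff_one _).1 this)
      obtain ⟨r, rfl⟩ := Ideal.mem_span_singleton'.1 hm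
      exact ⟨n, hn, r, hnm⟩
    have hfin : Module.Finite (integralClosure V K) f.crossedProductOrder :=
      Module.Finite.equiv f.coeffEquiv.symm
    have htop : (⊤ : Submodule (integralClosure V K) f.crossedProductOrder) ≤
        N.restrictScalars _ := by
      refine Submodule.le_of_le_smul_of_le_jacobson_bot (I := Ideal.span {π})
        Module.Finite.fg_top ?_ fun a _ => ?_
      · rw [Ideal.span_singleton_le_iff_mem, Ideal.jacobson, Submodule.mem_sInf]
        exact fun M hM => have := hM.2; algebraMap_mem_of_isMaximal hp M
      · refine Submodule.mem_sup.2 ⟨a * n, N.mul_mem_left a hn, π • (a * r),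
          Submodule.smul_mem_smul (Ideal.mem_span_singleton_self π) trivial, ?_⟩
        rw [smul_def, scalar_algebraMap_mul, mul_assoc, ← mul_add, hr, mul_one]
    exact hN.ne_top ((Ideal.eq_top_iff_one _).2 (htop (x := 1) trivial))
  by_contra hle
  obtain ⟨n, hn, t, ht, hnt⟩ : ∃ n ∈ N, ∃ t ∈ f.radIdeal, n + t = 1 := by
    have := hN.1.2 (N ⊔ f.radIdeal) (left_lt_sup.2 hle)
    exact Submodule.mem_sup.1 ((Ideal.eq_top_iff_one _).1 this)
  obtain ⟨k, hk⟩ := exists_pow_coeff_mem ht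
  obtain ⟨z, hz⟩ := (f.exists_mul_scalar_iff p (t ^ k)).2 fun σ =>
    algebraMap_dvd_of_forall_mem hp _ (hk σ)
  have h1 : (∑ i ∈ Finset.range k, t ^ i) * n = 1 - t ^ k := by
    rw [eq_sub_of_add_eq hnt, ← neg_sub t, mul_neg, geom_sum_mul, neg_sub]
  refine hN.ne_top ((Ideal.eq_top_iff_one _).2 ?_)
  rw [← sub_add_cancel 1 (t ^ k), ← h1, ← hz]
  exact N.add_mem (N.mul_mem_left _ hn) (N.mul_mem_left _ hπ)

end Quotient

end IntegralTwoCocycle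

/-! ### The criterion for left ideals -/

namespace IntegralTwoCocycle

section LeftHereditary

variable {V F K : Type*} [CommRing V] [IsDomain V] [IsDiscreteValuationRing V]
  [Field F] [Algebra V F] [IsFractionRing V F]
  [Field K] [Algebra F K] [FiniteDimensional F K] [Algebra V K] [IsScalarTower V F K]
  [IsDedekindDomain (integralClosure V K)] [FaithfulSMul V (integralClosure V K)]
  [Algebra.Unramified V (integralClosure V K)]
  (f : IntegralTwoCocycle V F K)

theorem scalar_algebraMap_mul_cancel {p : V} (hp : Irreducible p) {a b : f.crossedProductOrder}
    (h : a * f.scalar (algebraMap V _ p) = b * f.scalar (algebraMap V _ p)) : a = b := by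
  have h0 : algebraMap V (integralClosure V K) p ≠ 0 := by simpa using hp.ne_zero
  refine order_ext fun σ => mul_right_cancel₀ h0 ?_
  simpa [coeff_mul_scalar] using congrArg (fun x => f.coeff x σ) h

theorem exists_forall_le (hf : ∀ σ τ, ∀ N : Ideal (integralClosure V K), N.IsMaximal →
    f.val σ τ ∉ N ^ 2) (M : Ideal (integralClosure V K)) [M.IsMaximal] :
    ∃ σ, ∀ ρ, f.Le M ρ σ := by
  obtain ⟨σ, hσ⟩ := Finite.exists_max (f.height M)
  exact ⟨σ, fun ρ => by_contra fun h =>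
    (height_lt ((f.le_total hf ρ σ).resolve_left h) h).not_ge (hσ ρ)⟩

/-- If `σ` is a greatest element for `M` and `w` is as in `exists_notMem_forall_dvd_mul`, then
`radIdeal * w x_σ` consists of multiples of `π`. -/
theorem dvd_coeff_mul_monomial {p : V} {M : Ideal (integralClosure V K)}
    [M.IsMaximal] {w : integralClosure V K} (hw : ∀ m ∈ M, algebraMap V _ p ∣ w * m)
    {σ : Gal(K/F)} (hσ : ∀ ρ, f.Le M ρ σ) {y : f.crossedProductOrder} (hy : y ∈ f.radIdeal)
    (ρ : Gal(K/F)) : algebraMap V _ p ∣ f.coeff (y * f.monomial σ w) ρ := by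
  rw [coeff_mul_monomial]
  set κ := ρ * σ⁻¹
  have hm : galAct V κ⁻¹ (f.coeff y κ * f.val κ σ) ∈ M := by
    rw [map_mul]
    by_cases hle : f.Le M κ⁻¹ 1
    · refine M.mul_mem_right _ ?_
      simpa using galAct_coeff_mem_of_mem_radIdeal hy hle (f.one_le M κ⁻¹)
    · refine M.mul_mem_left _ ?_
      have h := f.galAct_val_mul_val κ⁻¹ σ
      rw [inv_inv] at h
      have hM : f.val κ⁻¹ κ ∈ M := by simpa [Le] using hle
      rw [← h] at hM
      refine (‹M.IsMaximal›.isPrime.mem_or_mem hM).resolve_right ?_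
      simpa [Le] using hσ κ⁻¹
  have h := map_dvd (galAct V κ) (hw _ hm)
  rw [map_mul, galAct_galAct_inv, AlgEquiv.commutes] at h
  convert h using 1
  ring

/-- The element `t` has to make up for the valuation at `M` of `f(σ, σ⁻¹)`: it is `π` if this value
is a unit at `M`, and `σ⁻¹(w)` if the valuation is `1`. -/
theorem exists_monomial_inv_mem_radIdeal {p : V} (hp : Irreducible p)
    {M : Ideal (integralClosure V K)} [hM : M.IsMaximal] {w : integralClosure V K} (hwM : w ∉ M)
    (hw : ∀ m ∈ M, algebraMap V _ p ∣ w * m) (σ : Gal(K/F)) (hσ : f.val σ σ⁻¹ ∉ M ^ 2) :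
    ∃ t, f.monomial σ⁻¹ t ∈ f.radIdeal ∧ ∃ z ∉ M,
      f.monomial σ w * f.monomial σ⁻¹ t = f.scalar (algebraMap V _ p * z) := by
  classical
  have hmem (t : integralClosure V K) (ht : ∀ N : Ideal (integralClosure V K), N.IsMaximal →
      f.val σ⁻¹ σ ∉ N → t ∈ N) : f.monomial σ⁻¹ t ∈ f.radIdeal := fun τ N hN hle => by
    rw [coeff_monomial]
    split_ifs with h
    · exact ht N hN (by simpa [Le, h] using hle)
    · exact N.zero_mem
  by_cases hval : f.val σ σ⁻¹ ∈ M
  · obtain ⟨z, hz⟩ := hw _ hval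
    refine ⟨galAct V σ⁻¹ w, hmem _ fun N hN hle => ?_, w * z, ?_, ?_⟩
    · have h : galAct V σ⁻¹ w * f.val σ⁻¹ σ ∈ N := by
        have h' := congrArg (galAct V σ⁻¹) hz
        have h'' := f.galAct_val σ⁻¹ 1
        simp only [inv_inv, mul_one, inv_one, one_mul, val_one_left] at h''
        rw [map_mul, map_mul, h'', AlgEquiv.commutes] at h'
        rw [h']
        exact N.mul_mem_right _ (algebraMap_mem_of_isMaximal hp N)
      exact (hN.isPrime.mem_or_mem h).resolve_right hle
    · refine fun h => (hM.isPrime.mem_or_mem h).elim hwM fun hzM => hσ ?_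
      have h2 : w * f.val σ σ⁻¹ ∈ M ^ 2 := by
        rw [hz, pow_two]
        exact Ideal.mul_mem_mul (algebraMap_mem_of_isMaximal hp M) hzM
      obtain ⟨u, m, hm, hum⟩ := hM.exists_inv hwM
      have h3 : f.val σ σ⁻¹ = u * (w * f.val σ σ⁻¹) + m * f.val σ σ⁻¹ := by
        rw [← mul_assoc, ← add_mul, hum, one_mul]
      rw [h3]
      exact add_mem ((M ^ 2).mul_mem_left _ h2) (pow_two M ▸ Ideal.mul_mem_mul hm hval)
    · rw [monomial_mul_monomial, galAct_galAct_inv, mul_inv_cancel, mul_assoc, hz]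
      exact congrArg (f.monomial 1) (by ring)
  · refine ⟨algebraMap V _ p, hmem _ fun N hN _ => algebraMap_mem_of_isMaximal hp N,
      w * f.val σ σ⁻¹, fun h => (hM.isPrime.mem_or_mem h).elim hwM hval, ?_⟩
    rw [monomial_mul_monomial, AlgEquiv.commutes, mul_inv_cancel]
    exact congrArg (f.monomial 1) (by ring)

theorem projective_radIdeal (hf : ∀ σ τ, ∀ N : Ideal (integralClosure V K), N.IsMaximal →
    f.val σ τ ∉ N ^ 2) : Module.Projective f.crossedProductOrder f.radIdeal := by
  obtain ⟨p, hp⟩ := IsDiscreteValuationRing.exists_irreducible V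
  set π := algebraMap V (integralClosure V K) p
  let X : Set f.crossedProductOrder := {z | ∃ c, ∃ t ∈ f.radIdeal, c * t = z ∧
    ∀ y ∈ f.radIdeal, ∃ b, b * f.scalar π = y * c}
  -- the `z` such that `z π` is a combination of the products `c * t`; no maximal ideal contains `𝔟`
  let 𝔟 : Ideal (integralClosure V K) := (Submodule.span (integralClosure V K) X).comap
    (LinearMap.toSpanSingleton _ _ (f.scalar π))
  have h𝔟 : 𝔟 = ⊤ := by
    by_contra hne
    obtain ⟨M, hM, hle⟩ := Ideal.exists_le_maximal 𝔟 hne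
    obtain ⟨σ, hσ⟩ := f.exists_forall_le hf M
    obtain ⟨w, hwM, hw⟩ := exists_notMem_forall_dvd_mul hp M
    obtain ⟨t, ht, z, hz, htz⟩ :=
      f.exists_monomial_inv_mem_radIdeal hp hwM hw σ (hf σ σ⁻¹ M hM)
    refine hz (hle (Submodule.subset_span ⟨f.monomial σ w, _, ht, htz.trans ?_, fun y hy =>
      (f.exists_mul_scalar_iff p _).2 fun ρ => f.dvd_coeff_mul_monomial hw hσ hy ρ⟩))
    rw [LinearMap.toSpanSingleton_apply, smul_def, mul_comm, map_mul]
  have h1 : f.scalar π ∈ Submodule.span (integralClosure V K) X := by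
    have h : (1 : integralClosure V K) ∈ 𝔟 := h𝔟 ▸ Submodule.mem_top
    simpa [𝔟] using h
  obtain ⟨n, s, g, hsum⟩ := Submodule.mem_span_set'.1 h1
  choose c t ht hct hc using fun i => (g i).2
  refine Ideal.projective_of_sum_mul_eq (ϖ := f.scalar π) (f.scalar_algebraMap_mul p)
    (fun a b => f.scalar_algebraMap_mul_cancel hp) _ (fun i => f.scalar (s i) * c i)
    (fun i => ⟨t i, ht i⟩) (fun i y hy => ?_) ?_
  · rw [← mul_assoc]
    exact hc i _ (f.radIdeal.mul_mem_right _ hy)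
  · rw [← hsum]
    refine Finset.sum_congr rfl fun i _ => ?_
    rw [mul_assoc, hct, smul_def]

theorem projective_ideal (hf : ∀ σ τ, ∀ N : Ideal (integralClosure V K), N.IsMaximal →
    f.val σ τ ∉ N ^ 2) (I : Ideal f.crossedProductOrder) :
    Module.Projective f.crossedProductOrder I := by
  obtain ⟨p, hp⟩ := IsDiscreteValuationRing.exists_irreducible V
  have h0 : algebraMap V (integralClosure V K) p ≠ 0 := by simpa using hp.ne_zero
  have := f.isSemisimpleRing_quotient_radIdeal
  have := f.projective_radIdeal hf
  have := f.isNoetherianRing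
  have := f.isSemisimpleRing_crossedProduct
  refine f.crossedProductOrder.projective_ideal_of_isSemisimpleRing
    (ϖ := f.scalar (algebraMap V _ p)) (fun b => ?_) (f.exists_pow_mul_mem_order hp)
    (fun L k hk => ?_) I
  · rw [coe_scalar_mul, mul_coe_scalar_algebraMap]
    rfl
  · have := f.isArtinian_quotient L (pow_ne_zero k h0) fun a => by
      rw [smul_def, ← map_pow, scalar_algebraMap_mul, map_pow, map_pow]
      exact L.mul_mem_left a hk
    exact L.projective_of_isArtinian_quotient fun N hN =>
      .of_isSemisimpleRing_quotient f.radIdeal (f.radIdeal_le_of_isMaximal N hN)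

theorem val_notMem_sq (h : ∀ I : Ideal f.crossedProductOrder,
    Module.Projective f.crossedProductOrder I) (τ γ : Gal(K/F))
    (M : Ideal (integralClosure V K)) (hM : M.IsMaximal) : f.val τ γ ∉ M ^ 2 := by
  intro hτ
  replace hτ : f.val τ τ⁻¹ ∈ M ^ 2 := (M ^ 2).mem_of_dvd (f.val_dvd_val_inv τ γ) hτ
  obtain ⟨p, hp⟩ := IsDiscreteValuationRing.exists_irreducible V
  set π := algebraMap V (integralClosure V K) p with hπ
  have hπM : π ∈ M := algebraMap_mem_of_isMaximal hp M
  have := h (Ideal.span {f.scalar π, f.monomial τ⁻¹ 1})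
  obtain ⟨n, c, t, hc, hsum⟩ := Ideal.exists_sum_mul_eq_of_projective
    (f.scalar_algebraMap_mul p) (Ideal.span {f.scalar π, f.monomial τ⁻¹ 1})
    (Ideal.subset_span (Or.inl rfl)) (Submodule.fg_span (by simp))
  -- if `f(σ, σ⁻¹)` is a unit at `M`, then `x_{τ⁻¹} c_i ∈ π A` forces `c_i(σ)` into `M`
  have hcM (i : Fin n) (σ : Gal(K/F)) (hσ : f.val σ σ⁻¹ ∉ M) : f.coeff (c i) σ ∈ M := by
    obtain ⟨z, hz⟩ := hc i (f.monomial τ⁻¹ 1) (Ideal.subset_span (by simp))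
    have h1 := congrArg (fun x => galAct V τ (f.coeff x (τ⁻¹ * σ))) hz
    simp only [coeff_scalar_mul, coeff_monomial_mul, inv_inv, mul_inv_cancel_left, one_mul,
      map_mul, galAct_galAct_inv, AlgEquiv.commutes] at h1
    have h2 : galAct V τ (f.val τ⁻¹ σ) ∉ M := fun h2 => hσ <| by
      have h3 := congrArg (galAct V τ) (f.val_mul_val τ⁻¹ σ σ⁻¹)
      rw [mul_inv_cancel, val_one_right, mul_one, map_mul, galAct_galAct_inv] at h3
      exact h3 ▸ M.mul_mem_left _ h2
    exact (hM.isPrime.mem_or_mem (h1 ▸ M.mul_mem_right _ hπM)).resolve_right h2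
  have hterm (i : Fin n) (σ : Gal(K/F)) : f.coeff (c i) σ * galAct V σ (f.coeff (t i) σ⁻¹) *
      f.val σ σ⁻¹ ∈ M ^ 2 := by
    obtain ⟨a, b, hab⟩ := Submodule.mem_span_pair.1 (t i).2
    rw [← hab]
    simp only [smul_eq_mul, coeff_add, coeff_mul_scalar, coeff_mul_monomial, inv_inv, map_one,
      mul_one, map_mul, map_add, galAct_galAct_inv]
    -- the part of `t_i` from `A x_{τ⁻¹}` contributes a multiple of `f(τ, τ⁻¹)`
    have h1 := f.val_mul_val σ (σ⁻¹ * τ) τ⁻¹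
    rw [mul_inv_cancel_left, mul_inv_cancel_right] at h1
    have h2 : f.coeff (c i) σ * f.val σ σ⁻¹ * π ∈ M ^ 2 := by
      rw [pow_two]
      refine Ideal.mul_mem_mul ?_ hπM
      by_cases hσ : f.val σ σ⁻¹ ∈ M
      · exact M.mul_mem_left _ hσ
      · exact M.mul_mem_right _ (hcM i σ hσ)
    convert add_mem ((M ^ 2).mul_mem_left (galAct V σ (f.coeff a σ⁻¹)) h2)
      ((M ^ 2).mul_mem_left (f.coeff (c i) σ * galAct V σ (f.coeff b (σ⁻¹ * τ)) *
        f.val σ (σ⁻¹ * τ)) hτ) using 1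
    linear_combination -(f.coeff (c i) σ * galAct V σ (f.coeff b (σ⁻¹ * τ))) * h1
  refine algebraMap_notMem_sq hp M ?_
  have h1 : π = ∑ i, ∑ σ, f.coeff (c i) σ * galAct V σ (f.coeff (t i) σ⁻¹) * f.val σ σ⁻¹ := by
    have h2 := congrArg (fun x => f.coeff x 1) hsum
    simpa [coeff_sum, coeff_mul, scalar] using h2.symm
  rw [← hπ, h1]
  exact sum_mem fun i _ => sum_mem fun σ _ => hterm i σ

end LeftHereditary

end IntegralTwoCocycle

/-! ### Right ideals -/

namespace IntegralTwoCocycle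

section Opposite

open MulOpposite

variable {V F K : Type*} [CommRing V] [Field F] [Algebra V F] [IsFractionRing V F]
  [Field K] [Algebra F K] [FiniteDimensional F K] [Algebra V K] [IsScalarTower V F K]
  (f : IntegralTwoCocycle V F K)

/-- The cocycle `(σ, τ) ↦ στ(f(τ⁻¹, σ⁻¹))`, which describes the multiplication of the elements
`x_{σ⁻¹}` in the opposite ring. -/
def opposite : IntegralTwoCocycle V F K where
  toFun x := Units.map ((x.1 * x.2 : Gal(K/F)) : K →* K) (f.toFun (x.2⁻¹, x.1⁻¹))
  isMulCocycle₂ σ τ ρ := Units.ext <| by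
    have h := congrArg (σ * τ * ρ) (f.cocycle ρ⁻¹ τ⁻¹ σ⁻¹)
    have hinv (x : K) : ρ (ρ⁻¹ x) = x := by
      rw [← AlgEquiv.mul_apply, mul_inv_cancel, AlgEquiv.one_apply]
    have hsmul (u : Kˣ) : ((σ • u : Kˣ) : K) = σ u := rfl
    simp only [map_mul, AlgEquiv.mul_apply, mul_inv_rev, Units.val_mul, Units.coe_map,
      MonoidHom.coe_coe, hsmul, hinv] at h ⊢
    rw [mul_comm, ← h, mul_comm]
  map_one_left σ := by simp [f.map_one_right]
  map_one_right σ := by simp [f.map_one_left]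
  integral σ τ := (f.integral τ⁻¹ σ⁻¹).map ((σ * τ : Gal(K/F)).toAlgHom.restrictScalars V)

theorem opposite_val (σ τ : Gal(K/F)) :
    f.opposite.val σ τ = galAct V (σ * τ) (f.val τ⁻¹ σ⁻¹) :=
  Subtype.ext (by rw [coe_galAct]; rfl)

@[simp] theorem coeff_coeffEquiv_symm (c : Gal(K/F) → integralClosure V K) (σ : Gal(K/F)) :
    f.coeff (f.coeffEquiv.symm c) σ = c σ := f.coeff_sum_monomial c σ

/-- The opposite of the crossed-product order is the crossed-product order of the opposite cocycle,
with `s x_σ` corresponding to `x_{σ⁻¹} s = σ⁻¹(s) x_{σ⁻¹}`. -/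
noncomputable def oppositeOrderEquiv :
    f.opposite.crossedProductOrder ≃+* f.crossedProductOrderᵐᵒᵖ where
  toFun a := op (f.coeffEquiv.symm fun σ => galAct V σ (f.opposite.coeff a σ⁻¹))
  invFun b := f.opposite.coeffEquiv.symm fun σ => galAct V σ (f.coeff (unop b) σ⁻¹)
  left_inv a := order_ext fun σ => by simp
  right_inv b := unop_injective (order_ext fun σ => by simp)
  map_add' a b := unop_injective (order_ext fun σ => by simp)
  map_mul' a b := unop_injective <| order_ext fun σ => by
    rw [unop_op, unop_mul, unop_op, unop_op, coeff_coeffEquiv_symm, coeff_mul, coeff_mul, map_sum]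
    refine Fintype.sum_equiv (Equiv.mulLeft σ) _ _ fun τ => ?_
    simp only [Equiv.coe_mulLeft, coeff_coeffEquiv_symm, opposite_val, map_mul, mul_inv_rev,
      inv_inv, ← galAct_mul]
    have e₁ : σ * (τ * (τ⁻¹ * σ⁻¹)) = 1 := by group
    have e₂ : σ * τ * (τ⁻¹ * σ⁻¹ * σ) = σ := by group
    rw [e₁, e₂, galAct_one, inv_mul_cancel_right, inv_mul_cancel_left,
      mul_comm (galAct V σ _)]

theorem opposite_val_notMem_sq
    (hf : ∀ σ τ, ∀ M : Ideal (integralClosure V K), M.IsMaximal → f.val σ τ ∉ M ^ 2)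
    (σ τ : Gal(K/F)) (M : Ideal (integralClosure V K)) (hM : M.IsMaximal) :
    f.opposite.val σ τ ∉ M ^ 2 := by
  rw [opposite_val, ← Ideal.mem_comap_pow_iff]
  exact hf _ _ _ (Ideal.comap_isMaximal_of_equiv (galAct V (σ * τ)))

end Opposite

end IntegralTwoCocycle

theorem corollary1 {V F K : Type*} [CommRing V] [IsDomain V] [IsDiscreteValuationRing V]
    [Field F] [Algebra V F] [IsFractionRing V F]
    [Field K] [Algebra F K] [FiniteDimensional F K] [IsGalois F K]
    [Algebra V K] [IsScalarTower V F K]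
    [Algebra.Unramified V (integralClosure V K)]
    (f : IntegralTwoCocycle V F K) :
    (IsHereditaryRing f.crossedProductOrder ↔
      ∀ (τ γ : Gal(K/F)) (M : Ideal (integralClosure V K)), M.IsMaximal → f.val τ γ ∉ M ^ 2) ∧
    (IsHereditaryRing f.crossedProductOrder ↔
      ∀ τ γ : Gal(K/F), Squarefree (f.val τ γ)) := by
  have := isDedekindDomain_integralClosure V F K
  have := faithfulSMul_integralClosure V F K
  have := isPrincipalIdealRing_of_isIntegral V (integralClosure V K)
  have key : IsHereditaryRing f.crossedProductOrder ↔
      ∀ (τ γ : Gal(K/F)) (M : Ideal (integralClosure V K)), M.IsMaximal → f.val τ γ ∉ M ^ 2 :=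
    ⟨fun h => f.val_notMem_sq h.1, fun h => ⟨f.projective_ideal h,
      Module.Projective.forall_ideal_of_ringEquiv f.oppositeOrderEquiv
        (f.opposite.projective_ideal (f.opposite_val_notMem_sq h))⟩⟩
  exact ⟨key, by simpa only [squarefree_iff_forall_notMem_sq] using key⟩
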